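/- Let $V$ be a two-sided quaternionic Banach space (a real Banach space with commuting left and right scalar multiplications by the quaternions $\mathbb{H}$ that both extend multiplication by reals and satisfy $\|av\|=\|va\|=|a|\,\|v\|$). Let $(\mathcal{Z}_T(t))_{t\in\mathbb{R}}$ be a strongly continuous group of bounded right linear operators on $V$ with infinitesimal generator $T$, i.e. $Tv=\lim_{h\to0^+}\frac1h(\mathcal{Z}_T(h)v-v)$ on the set $\mathcal{D}(T)$ of all $v$ for which this limit exists, and let $M>0$ and $\omega\ge 0$ be such that $\|\mathcal{Z}_T(t)\|\le Me^{\omega|t|}$ for all $t\in\mathbb{R}$. For $s\in\mathbb{H}$ let $\mathcal{R}_s(T)=T^2-2\operatorname{Re}(s)T+|s|^2\mathcal{I}$ on $\mathcal{D}(T^2)=\{v\in\mathcal{D}(T): Tv\in\mathcal{D}(T)\}$. The $S$-resolvent set $\rho_S(T)$ consists of those $s$ for which $\mathcal{R}_s(T)$ has trivial kernel and dense range and $\mathcal{R}_s(T)^{-1}$ is a bounded right linear operator on $V$; for $s\in\rho_S(T)$ put $S_R^{-1}(s,T)=-(T-\overline{s}\,\mathcal{I})\mathcal{R}_s(T)^{-1}$.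 Let $I\in\mathbb{H}$ be an imaginary unit ($\operatorname{Re} I=0$, $|I|=1$), $\mathbb{C}_I=\mathbb{R}+I\mathbb{R}$, $W_c=\{s\in\mathbb{H}:-c<\operatorname{Re}(s)<c\}$, and $ds_I=-ds\,I$. The positively oriented boundary $\partial(W_c\cap\mathbb{C}_I)$ consists of the two lines $s=c+I\tau$ and $s=-c-I\tau$, $\tau\in\mathbb{R}$. Let $\alpha$ and $c$ be real numbers with $\omega<c<|\alpha|$. Then $\partial(W_c\cap\mathbb{C}_I)\subset\rho_S(T)$, and for every $u\in\mathcal{D}(T^2)$ and every $t\in\mathbb{R}$ the following integral converges absolutely and \[ \mathcal{Z}_T(t)u=\frac{1}{2\pi}\int_{\partial(W_c\cap\mathbb{C}_I)}e^{ts}(\alpha-s)^{-2}\,ds_I\,S_R^{-1}(s,T)\,(\alpha\mathcal{I}-T)^2u . \] -/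

import Mathlib

open scoped Quaternion

noncomputable section

namespace QuatGroup

/-! Partially defined right linear operators. A right quaternionic vector space is a module over the
opposite ring `ℍ[ℝ]ᵐᵒᵖ`; an unbounded right linear operator on `V` is a `V →ₗ.[ℍ[ℝ]ᵐᵒᵖ] V`. -/

section Partial

variable {V : Type*} [AddCommGroup V] [Module ℝ V] [Module ℍ[ℝ]ᵐᵒᵖ V] [IsScalarTower ℝ ℍ[ℝ]ᵐᵒᵖ V]

/-- The square `T²`, with domain `D(T²) = {x ∈ D(T) : T x ∈ D(T)}`. -/
def opSq (T : V →ₗ.[ℍ[ℝ]ᵐᵒᵖ] V) : V →ₗ.[ℍ[ℝ]ᵐᵒᵖ] V where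
  domain :=
    { carrier := {x | ∃ hx : x ∈ T.domain, T ⟨x, hx⟩ ∈ T.domain}
      zero_mem' := ⟨T.domain.zero_mem, by
        have h : T ⟨0, T.domain.zero_mem⟩ = 0 := T.map_zero
        rw [h]; exact T.domain.zero_mem⟩
      add_mem' := by
        rintro x y ⟨hx, hx'⟩ ⟨hy, hy'⟩
        refine ⟨T.domain.add_mem hx hy, ?_⟩
        have h : T ⟨x + y, T.domain.add_mem hx hy⟩ = T ⟨x, hx⟩ + T ⟨y, hy⟩ :=
          T.map_add ⟨x, hx⟩ ⟨y, hy⟩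
        rw [h]; exact T.domain.add_mem hx' hy'
      smul_mem' := by
        rintro q x ⟨hx, hx'⟩
        refine ⟨T.domain.smul_mem q hx, ?_⟩
        have h : T ⟨q • x, T.domain.smul_mem q hx⟩ = q • T ⟨x, hx⟩ := T.map_smul q ⟨x, hx⟩
        rw [h]; exact T.domain.smul_mem q hx' }
  toFun :=
    { toFun := fun x => T ⟨T ⟨x.1, x.2.1⟩, x.2.2⟩
      map_add' := by
        rintro ⟨x, hx, hx'⟩ ⟨y, hy, hy'⟩
        rw [← T.map_add]
        congr 1
        exact Subtype.ext (T.map_add ⟨x, hx⟩ ⟨y, hy⟩)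
      map_smul' := by
        rintro q ⟨x, hx, hx'⟩
        rw [RingHom.id_apply, ← T.map_smul]
        congr 1
        exact Subtype.ext (T.map_smul q ⟨x, hx⟩) }

/-- The operator `α I - T` for real `α`, with domain `D(T)`. -/
def realSub (α : ℝ) (T : V →ₗ.[ℍ[ℝ]ᵐᵒᵖ] V) : V →ₗ.[ℍ[ℝ]ᵐᵒᵖ] V where
  domain := T.domain
  toFun := α • T.domain.subtype - T.toFun

/-- `D(T²) ⊆ D((α I - T)²)`, so that `(α I - T)² u` makes sense for `u ∈ D(T²)`. -/
theorem mem_domain_opSq_realSub (α : ℝ) (T : V →ₗ.[ℍ[ℝ]ᵐᵒᵖ] V) {u : V} (hu : u ∈ (opSq T).domain) :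
    u ∈ (opSq (realSub α T)).domain :=
  ⟨hu.1, T.domain.sub_mem (T.domain.smul_of_tower_mem α hu.1) hu.2⟩

/-- The operator `R_s(T) = T² - 2 Re(s) T + |s|² I` on `D(T²)`. -/
def quadOp (T : V →ₗ.[ℍ[ℝ]ᵐᵒᵖ] V) (s : ℍ[ℝ]) (x : (opSq T).domain) : V :=
  opSq T x - (2 * s.re) • T ⟨x.1, x.2.1⟩ + (‖s‖ ^ 2) • x.1

end Partial

section Analytic

variable {V : Type*} [NormedAddCommGroup V] [NormedSpace ℝ V]
  [Module ℍ[ℝ]ᵐᵒᵖ V]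

/-- `B` is the inverse `R_s(T)⁻¹ ∈ B(V)`: it maps `V` into `D(T²)` and `R_s(T) B v = v`
for all `v ∈ V`. -/
def IsRightInverseQuadOp (T : V →ₗ.[ℍ[ℝ]ᵐᵒᵖ] V) (s : ℍ[ℝ]) (B : V →L[ℍ[ℝ]ᵐᵒᵖ] V) : Prop :=
  ∀ v, ∃ h : B v ∈ (opSq T).domain, quadOp T s ⟨B v, h⟩ = v

/-- The `S`-resolvent set `ρ_S(T)`: those `s` for which `R_s(T)` has trivial kernel and dense range
and `R_s(T)⁻¹ ∈ B(V)`. -/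
def sResolventSet (T : V →ₗ.[ℍ[ℝ]ᵐᵒᵖ] V) : Set ℍ[ℝ] :=
  {s | (∀ x : (opSq T).domain, quadOp T s x = 0 → x = 0) ∧ DenseRange (quadOp T s) ∧
    ∃ B : V →L[ℍ[ℝ]ᵐᵒᵖ] V, IsRightInverseQuadOp T s B}

/-- For `s ∈ ρ_S(T)`, the inverse `R_s(T)⁻¹` of `R_s(T)`; it is unique as `ker R_s(T) = 0`. -/
def quadInv (T : V →ₗ.[ℍ[ℝ]ᵐᵒᵖ] V) (s : ℍ[ℝ]) (hs : s ∈ sResolventSet T) : V →L[ℍ[ℝ]ᵐᵒᵖ] V :=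
  hs.2.2.choose

theorem quadInv_spec (T : V →ₗ.[ℍ[ℝ]ᵐᵒᵖ] V) (s : ℍ[ℝ]) (hs : s ∈ sResolventSet T) :
    IsRightInverseQuadOp T s (quadInv T s hs) :=
  hs.2.2.choose_spec

/-- Strongly continuous groups of bounded right linear operators. -/
structure IsStronglyContinuousGroup (Z : ℝ → V →L[ℍ[ℝ]ᵐᵒᵖ] V) : Prop where
  map_zero : Z 0 = ContinuousLinearMap.id _ V
  map_add : ∀ t₁ t₂, Z (t₁ + t₂) = (Z t₁).comp (Z t₂)
  continuous_apply : ∀ v, Continuous fun t => Z t v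

/-- The difference quotients `(Z(h) v - v) / h` converge to `w` as `h → 0⁺`. -/
def HasGenValue (Z : ℝ → V →L[ℍ[ℝ]ᵐᵒᵖ] V) (v w : V) : Prop :=
  Filter.Tendsto (fun h : ℝ => h⁻¹ • (Z h v - v)) (nhdsWithin 0 (Set.Ioi 0)) (nhds w)

theorem HasGenValue.add {Z : ℝ → V →L[ℍ[ℝ]ᵐᵒᵖ] V} {v w v' w' : V}
    (h : HasGenValue Z v w) (h' : HasGenValue Z v' w') : HasGenValue Z (v + v') (w + w') := by
  refine (Filter.Tendsto.add h h').congr fun r => ?_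
  rw [map_add, ← smul_add]
  congr 1
  abel

theorem HasGenValue.unique {Z : ℝ → V →L[ℍ[ℝ]ᵐᵒᵖ] V} {v w w' : V}
    (h : HasGenValue Z v w) (h' : HasGenValue Z v w') : w = w' :=
  tendsto_nhds_unique h h'

theorem HasGenValue.smul [IsScalarTower ℝ ℍ[ℝ]ᵐᵒᵖ V] [NormSMulClass ℍ[ℝ]ᵐᵒᵖ V]
    {Z : ℝ → V →L[ℍ[ℝ]ᵐᵒᵖ] V} {v w : V} (q : ℍ[ℝ]ᵐᵒᵖ)
    (h : HasGenValue Z v w) : HasGenValue Z (q • v) (q • w) := by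
  have : SMulCommClass ℝ ℍ[ℝ]ᵐᵒᵖ V := IsScalarTower.to_smulCommClass
  refine (Filter.Tendsto.const_smul h q).congr fun r => ?_
  rw [map_smul, ← smul_sub, smul_comm]

/-- The infinitesimal generator `T`: `D(T)` is the set of `v` for which
`lim_{h → 0⁺} (Z(h) v - v) / h` exists, and `T v` is that limit. -/
def generator [IsScalarTower ℝ ℍ[ℝ]ᵐᵒᵖ V] [NormSMulClass ℍ[ℝ]ᵐᵒᵖ V]
    (Z : ℝ → V →L[ℍ[ℝ]ᵐᵒᵖ] V) : V →ₗ.[ℍ[ℝ]ᵐᵒᵖ] V where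
  domain :=
    { carrier := {v | ∃ w, HasGenValue Z v w}
      zero_mem' := ⟨0, by simp [HasGenValue]⟩
      add_mem' := by
        rintro v v' ⟨w, h⟩ ⟨w', h'⟩
        exact ⟨w + w', h.add h'⟩
      smul_mem' := by
        rintro q v ⟨w, h⟩
        exact ⟨q • w, h.smul q⟩ }
  toFun :=
    { toFun := fun v => v.2.choose
      map_add' := fun v v' =>
        (v + v').2.choose_spec.unique (v.2.choose_spec.add v'.2.choose_spec)
      map_smul' := fun q v => (q • v).2.choose_spec.unique (v.2.choose_spec.smul q) }

variable [Module ℍ[ℝ] V]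

open Classical in
/-- The right `S`-resolvent operator
`S_R⁻¹(s, T) v = -(T - s̄ I) (T² - 2 Re(s) T + |s|² I)⁻¹ v` for `s ∈ ρ_S(T)`
(and `0` by convention for `s ∉ ρ_S(T)`). -/
def sResolventR (T : V →ₗ.[ℍ[ℝ]ᵐᵒᵖ] V) (s : ℍ[ℝ]) (v : V) : V :=
  if hs : s ∈ sResolventSet T then
    -(T ⟨quadInv T s hs v, (quadInv_spec T s hs v).1.1⟩ - star s • quadInv T s hs v)
  else 0

/-- The sphere `𝕊` of imaginary units of the quaternions. -/
def imagUnits : Set ℍ[ℝ] := {I | I.re = 0 ∧ ‖I‖ = 1}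

/-- The integrand of `∫ f(s) ds_I g(s)`, `ds_I = -ds I`, along the line `s = a + τ b`, `τ ∈ ℝ`
(so `ds = b dτ`). -/
def lineIntegrand (I a b : ℍ[ℝ]) (f : ℍ[ℝ] → ℍ[ℝ]) (g : ℍ[ℝ] → V) (τ : ℝ) : V :=
  (f (a + τ • b) * (-(b * I))) • g (a + τ • b)

/-- Both lines of `∂(W_c ∩ ℂ_I)` carry an absolutely convergent integral `∫ f(s) ds_I g(s)`. -/
def StripIntegrable (c : ℝ) (I : ℍ[ℝ]) (f : ℍ[ℝ] → ℍ[ℝ]) (g : ℍ[ℝ] → V) : Prop :=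
  MeasureTheory.Integrable (lineIntegrand I (c : ℍ[ℝ]) I f g) ∧
    MeasureTheory.Integrable (lineIntegrand I (-(c : ℍ[ℝ])) (-I) f g)

/-- `∫_{∂(W_c ∩ ℂ_I)} f(s) ds_I g(s)`, where `W_c = {-c < Re s < c}` and the positively oriented
boundary of `W_c ∩ ℂ_I` consists of the lines `s = c + I τ` and `s = -c - I τ`, `τ ∈ ℝ`. -/
def stripIntegral (c : ℝ) (I : ℍ[ℝ]) (f : ℍ[ℝ] → ℍ[ℝ]) (g : ℍ[ℝ] → V) : V :=
  (∫ τ : ℝ, lineIntegrand I (c : ℍ[ℝ]) I f g τ) +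
    ∫ τ : ℝ, lineIntegrand I (-(c : ℍ[ℝ])) (-I) f g τ

end Analytic

end QuatGroup

end

open QuatGroup

noncomputable section

namespace QuatGroup

open MeasureTheory Set Filter Topology

/-! ### The complex plane `ℂ_I` -/

/-! On the line Re s = c > ω the right S-resolvent is a Laplace transform, S_R⁻¹(s,T)v = ∫₀^∞
e^{-rs} Z(r)v dr; on Re s = -c, reversing time gives -∫₀^∞ e^{rs} Z(-r)v dr (`sResolventR_right`,
`sResolventR_left`). Insert these in the strip integral and apply Fubini, which the decay of (α -
s)⁻² permits. Only the scalar integrals of e^{(t-r)s}(α - s)⁻² along vertical lines remain, and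
Fourier inversion evaluates them to real numbers. For α > c the right line contributes the part r >
0, and the left line the part r < 0, of 2π ∫_ℝ (r - t)₊ e^{α(t-r)} Z(r)v dr. The shift r ↦ r + t
turns this into 2π Z(t) ∫₀^∞ r e^{-αr} Z(r)v dr = 2π Z(t)(α - T)⁻²v (`integral_lineTransform_add`),
and v = (α - T)²u gives the claim. For α < -c the same argument runs for the group Z(-t), generated
by -T.

Since Z(r) is only right linear, it need not commute with left multiplication by e^{-rs}. The
resolvent is therefore built from the real kernels e^{-ar} sin(br)/b and e^{-ar} cos(br), where s =
a + Ib. Their span is invariant under translation, so T acts on the corresponding integrals by a 2×2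
real system with a source term (`hasGenValue_kernelIntegral`). It follows that the sine kernel gives
R_s(T)⁻¹, and that s̄ R_s(T)⁻¹ - T R_s(T)⁻¹ is the Laplace transform. -/

theorem imagUnits.mul_self {I : ℍ[ℝ]} (hI : I ∈ imagUnits) : I * I = -1 := by
  obtain ⟨h0, h1⟩ := hI
  have h := Quaternion.normSq_eq_norm_mul_self I
  rw [h1, Quaternion.normSq_def', h0] at h
  ext <;> simp [h0]
  · nlinarith
  all_goals ring

/-- The embedding of `ℂ` onto the plane `ℂ_I = ℝ + I ℝ`. -/
def planeHom (I : ℍ[ℝ]) (hI : I ∈ imagUnits) : ℂ →ₐ[ℝ] ℍ[ℝ] :=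
  Complex.lift ⟨I, imagUnits.mul_self hI⟩

theorem planeHom_apply {I : ℍ[ℝ]} (hI : I ∈ imagUnits) (z : ℂ) :
    planeHom I hI z = (z.re : ℍ[ℝ]) + z.im • I := rfl

theorem norm_planeHom {I : ℍ[ℝ]} (hI : I ∈ imagUnits) (z : ℂ) : ‖planeHom I hI z‖ = ‖z‖ := by
  obtain ⟨h0, h1⟩ := id hI
  have h := Quaternion.normSq_eq_norm_mul_self I
  rw [h1, Quaternion.normSq_def', h0] at h
  have h2 : ‖planeHom I hI z‖ ^ 2 = ‖z‖ ^ 2 := by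
    rw [sq ‖planeHom I hI z‖, ← Quaternion.normSq_eq_norm_mul_self, ← Complex.normSq_eq_norm_sq,
      Complex.normSq_apply, planeHom_apply, Quaternion.normSq_def']
    simp [h0]
    nlinarith
  exact (sq_eq_sq₀ (norm_nonneg _) (norm_nonneg _)).1 h2

theorem continuous_planeHom {I : ℍ[ℝ]} (hI : I ∈ imagUnits) : Continuous (planeHom I hI) :=
  (planeHom I hI).toLinearMap.continuous_of_finiteDimensional

/-! ### The inverse Laplace transform of `(α - s)⁻²` -/

/-- The point `c + i τ` of the vertical line `Re z = c`. -/
def linePt (c τ : ℝ) : ℂ := c + τ * Complex.I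

@[simp] theorem linePt_re (c τ : ℝ) : (linePt c τ).re = c := by simp [linePt]

@[simp] theorem linePt_im (c τ : ℝ) : (linePt c τ).im = τ := by simp [linePt]

theorem continuous_linePt (c : ℝ) : Continuous (linePt c) := by
  unfold linePt; fun_prop

theorem sub_linePt_ne_zero {α c : ℝ} (h : α ≠ c) (τ : ℝ) : (α : ℂ) - linePt c τ ≠ 0 := by
  intro h0
  have := congrArg Complex.re h0
  simp at this
  exact h (by linarith)

theorem norm_sub_linePt_zpow (α c τ : ℝ) :
    ‖((α : ℂ) - linePt c τ) ^ (-2 : ℤ)‖ = ((α - c) ^ 2 + τ ^ 2)⁻¹ := by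
  rw [norm_zpow, zpow_neg]
  congr 1
  rw [show (2 : ℤ) = ((2 : ℕ) : ℤ) from rfl, zpow_natCast, ← Complex.normSq_eq_norm_sq,
    Complex.normSq_apply]
  simp
  ring

theorem integrable_inv_sq_add_sq {δ : ℝ} (hδ : δ ≠ 0) :
    Integrable fun τ : ℝ => (δ ^ 2 + τ ^ 2)⁻¹ := by
  have h := (integrable_inv_one_add_sq.comp_mul_left' (inv_ne_zero hδ)).const_mul (δ ^ 2)⁻¹
  refine h.congr (ae_of_all _ fun τ => ?_)
  simp only
  rw [← mul_inv]
  congr 1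
  field_simp

theorem continuous_sub_linePt_zpow {α c : ℝ} (h : α ≠ c) :
    Continuous fun τ : ℝ => ((α : ℂ) - linePt c τ) ^ (-2 : ℤ) :=
  (continuous_const.sub (continuous_linePt c)).zpow₀ _ fun τ => Or.inl (sub_linePt_ne_zero h τ)

theorem integrable_sub_linePt_zpow {α c : ℝ} (h : α ≠ c) :
    Integrable fun τ : ℝ => ((α : ℂ) - linePt c τ) ^ (-2 : ℤ) := by
  refine (integrable_inv_sq_add_sq (sub_ne_zero.2 h)).mono'
    (continuous_sub_linePt_zpow h).aestronglyMeasurable (ae_of_all _ fun τ => ?_)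
  rw [norm_sub_linePt_zpow]

theorem integrableOn_mul_exp_neg {δ : ℝ} (hδ : 0 < δ) :
    IntegrableOn (fun r : ℝ => r * Real.exp (-δ * r)) (Ioi 0) := by
  simpa using integrableOn_rpow_mul_exp_neg_mul_rpow (p := 1) (s := 1) (b := δ) (by norm_num)
    one_pos hδ

theorem integral_mul_cexp_neg {z : ℂ} (hz : 0 < z.re) :
    ∫ r in Ioi (0 : ℝ), (r : ℂ) * Complex.exp (-z * r) = z ^ (-2 : ℤ) := by
  have hz0 : z ≠ 0 := fun h => by simp [h] at hz
  have hnorm : ∀ r : ℝ, ‖Complex.exp (-z * r)‖ = Real.exp (-z.re * r) := fun r => by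
    rw [Complex.norm_exp]; simp
  have hfi : IntegrableOn (fun r : ℝ => (r : ℂ) * Complex.exp (-z * r)) (Ioi 0) := by
    refine (integrableOn_mul_exp_neg hz).mono' (by fun_prop) ?_
    filter_upwards [ae_restrict_mem measurableSet_Ioi] with r hr
    rw [norm_mul, hnorm, Complex.norm_real, Real.norm_of_nonneg (le_of_lt hr)]
  have hexp : Tendsto (fun r : ℝ => Complex.exp (-z * r)) atTop (𝓝 0) := by
    rw [tendsto_zero_iff_norm_tendsto_zero]
    simp_rw [hnorm]
    refine Real.tendsto_exp_atBot.comp ?_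
    exact tendsto_id.const_mul_atTop_of_neg (by linarith)
  have hrexp : Tendsto (fun r : ℝ => (r : ℂ) * Complex.exp (-z * r)) atTop (𝓝 0) := by
    rw [tendsto_zero_iff_norm_tendsto_zero]
    have h := tendsto_rpow_mul_exp_neg_mul_atTop_nhds_zero 1 z.re hz
    refine h.congr' ?_
    filter_upwards [eventually_ge_atTop 0] with r hr
    rw [norm_mul, hnorm, Complex.norm_real, Real.norm_of_nonneg hr]
    simp
  -- The antiderivative comes from integration by parts; it equals -z⁻² at 0.
  have hder : ∀ r ∈ Ici (0 : ℝ), HasDerivAt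
      (fun r : ℝ => -(z⁻¹ * ((r : ℂ) * Complex.exp (-z * r)) + z⁻¹ ^ 2 * Complex.exp (-z * r)))
      ((r : ℂ) * Complex.exp (-z * r)) r := by
    intro r _
    have h1 : HasDerivAt (fun r : ℝ => (r : ℂ)) 1 r := Complex.ofRealCLM.hasDerivAt
    have h2 : HasDerivAt (fun r : ℝ => Complex.exp (-z * r)) (Complex.exp (-z * r) * (-z * 1)) r :=
      (h1.const_mul (-z)).cexp
    have h3 := (((h1.fun_mul h2).const_mul z⁻¹).fun_add (h2.const_mul (z⁻¹ ^ 2))).fun_neg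
    refine h3.congr_deriv ?_
    have hzz : z⁻¹ * z = 1 := inv_mul_cancel₀ hz0
    generalize z⁻¹ = y at hzz ⊢
    linear_combination (r * Complex.exp (-z * r) + y * Complex.exp (-z * r)) * hzz
  have hlim : Tendsto
      (fun r : ℝ => -(z⁻¹ * ((r : ℂ) * Complex.exp (-z * r)) + z⁻¹ ^ 2 * Complex.exp (-z * r)))
      atTop (𝓝 0) := by
    have h := ((hrexp.const_mul z⁻¹).add (hexp.const_mul (z⁻¹ ^ 2))).neg
    rwa [mul_zero, mul_zero, add_zero, neg_zero] at h
  rw [integral_Ioi_of_hasDerivAt_of_tendsto' hder hfi hlim]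
  simp [zpow_neg]

open FourierTransform in
/-- The inverse Laplace transform of `(δ - s)⁻²` along the imaginary axis. -/
theorem integral_cexp_mul_zpow {δ : ℝ} (hδ : 0 < δ) (x : ℝ) :
    ∫ τ : ℝ, Complex.exp (τ * x * Complex.I) * ((δ : ℂ) - τ * Complex.I) ^ (-2 : ℤ) =
      2 * Real.pi * (max (-x) 0 * Real.exp (δ * x) : ℝ) := by
  -- `g` has Fourier transform (δ - 2πiξ)⁻². It is continuous at its kink 0 and the transform is
  -- integrable because the pole is double, so the inversion formula holds at every point.
  set g : ℝ → ℂ := fun x => ((max (-x) 0 * Real.exp (δ * x) : ℝ) : ℂ) with hg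
  have hgc : Continuous g := by
    rw [hg]; fun_prop
  have hgi : Integrable g := by
    have h : Integrable fun x => g (-x) := by
      rw [← integrableOn_univ, ← Iic_union_Ioi (a := (0 : ℝ)), integrableOn_union]
      constructor
      · refine (integrableOn_zero).congr_fun (fun r hr => ?_) measurableSet_Iic
        simpa [hg] using hr
      · have h0 : IntegrableOn (fun r : ℝ => ((r * Real.exp (-δ * r) : ℝ) : ℂ)) (Ioi 0) :=
          (integrableOn_mul_exp_neg hδ).ofReal
        refine h0.congr_fun (fun r hr => ?_) measurableSet_Ioi
        have : 0 ≤ r := le_of_lt hr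
        simp [hg, this]
    simpa using h.comp_neg
  have hF : ∀ ξ : ℝ, 𝓕 g ξ = ((δ : ℂ) - linePt 0 (2 * Real.pi * ξ)) ^ (-2 : ℤ) := by
    intro ξ
    rw [Real.fourier_real_eq_integral_exp_smul, ← integral_neg_eq_self,
      ← integral_mul_cexp_neg (z := (δ : ℂ) - linePt 0 (2 * Real.pi * ξ)) (by simpa using hδ),
      ← integral_indicator measurableSet_Ioi]
    congr 1
    ext r
    by_cases hr : 0 < r
    · rw [indicator_of_mem (mem_Ioi.2 hr)]
      simp only [hg, neg_neg, max_eq_left hr.le, smul_eq_mul, linePt]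
      push_cast
      rw [mul_left_comm, ← Complex.exp_add]
      congr 2
      ring
    · rw [indicator_of_notMem (by simpa using hr)]
      simp [hg, not_lt.1 hr]
  have hFi : Integrable (𝓕 g) := by
    rw [show 𝓕 g = _ from funext hF]
    exact (integrable_sub_linePt_zpow hδ.ne').comp_mul_left' (R := 2 * Real.pi) (by positivity)
  have hinv := hgi.fourierInv_fourier_eq hFi hgc.continuousAt (v := x)
  rw [Real.fourierInv_eq'] at hinv
  simp_rw [hF] at hinv
  have hsub := Measure.integral_comp_mul_left
    (fun τ : ℝ => Complex.exp (τ * x * Complex.I) * ((δ : ℂ) - linePt 0 τ) ^ (-2 : ℤ))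
    (2 * Real.pi)
  have heq : (∫ ξ : ℝ, (fun τ : ℝ => Complex.exp (τ * x * Complex.I) *
      ((δ : ℂ) - linePt 0 τ) ^ (-2 : ℤ)) (2 * Real.pi * ξ)) = g x := by
    rw [← hinv]
    congr 1
    ext ξ
    simp only [smul_eq_mul, RCLike.inner_apply, conj_trivial]
    congr 2
    push_cast
    ring
  rw [heq, abs_of_pos (by positivity)] at hsub
  have h2 : (2 * Real.pi : ℝ) • g x = ∫ τ : ℝ, Complex.exp (τ * x * Complex.I) *
      ((δ : ℂ) - linePt 0 τ) ^ (-2 : ℤ) := by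
    rw [hsub, smul_smul, mul_inv_cancel₀ (by positivity), one_smul]
  simp only [linePt, Complex.ofReal_zero, zero_add] at h2
  rw [← h2, Complex.real_smul]
  simp [hg]

/-- The integral of `e^{xs} (α - s)⁻²` over the line `Re s = c` when the pole `α` lies to its
right. -/
theorem integral_line_of_lt {α c : ℝ} (h : c < α) (x : ℝ) :
    ∫ τ : ℝ, Complex.exp (x * linePt c τ) * ((α : ℂ) - linePt c τ) ^ (-2 : ℤ) =
      ((2 * Real.pi * (max (-x) 0 * Real.exp (α * x)) : ℝ) : ℂ) := by
  have h1 := integral_cexp_mul_zpow (sub_pos.2 h) x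
  have h2 : ∀ τ : ℝ, Complex.exp (x * linePt c τ) * ((α : ℂ) - linePt c τ) ^ (-2 : ℤ) =
      Complex.exp (x * c) * (Complex.exp (τ * x * Complex.I) *
        (((α - c : ℝ) : ℂ) - τ * Complex.I) ^ (-2 : ℤ)) := by
    intro τ
    rw [← mul_assoc, ← Complex.exp_add]
    unfold linePt
    push_cast
    ring_nf
  simp_rw [h2]
  rw [integral_const_mul, h1]
  have h3 : Real.exp (α * x) = Real.exp (x * c) * Real.exp ((α - c) * x) := by
    rw [← Real.exp_add]; ring_nf
  rw [h3]
  push_cast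
  ring

/-- The integral of `e^{xs} (α - s)⁻²` over the line `Re s = c` when the pole `α` lies to its
left. -/
theorem integral_line_of_gt {α c : ℝ} (h : α < c) (x : ℝ) :
    ∫ τ : ℝ, Complex.exp (x * linePt c τ) * ((α : ℂ) - linePt c τ) ^ (-2 : ℤ) =
      ((2 * Real.pi * (max x 0 * Real.exp (α * x)) : ℝ) : ℂ) := by
  -- The reflection s ↦ -s moves the pole to the other side of the line; the even power absorbs the
  -- sign.
  have h1 := integral_line_of_lt (neg_lt_neg h) (-x)
  rw [neg_neg, neg_mul_neg] at h1
  rw [← h1, ← integral_neg_eq_self]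
  congr 1
  ext τ
  have h2 : linePt c (-τ) = -linePt (-c) τ := by
    unfold linePt; push_cast; ring
  have h3 : ((-α : ℝ) : ℂ) - linePt (-c) τ = -((α : ℂ) - -linePt (-c) τ) := by
    push_cast; ring
  rw [h2, h3, Even.neg_zpow (by decide)]
  push_cast
  ring_nf

/-! ### The damped sine and cosine kernels -/

/-- The kernel `e^{-ar} sin(br) / b`, which for `b = 0` is `r e^{-ar}`. -/
def dampedSin (a b r : ℝ) : ℝ := Real.exp (-a * r) * (r * Real.sinc (b * r))

/-- The kernel `e^{-ar} cos(br)`. -/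
def dampedCos (a b r : ℝ) : ℝ := Real.exp (-a * r) * Real.cos (b * r)

theorem continuous_dampedSin (a b : ℝ) : Continuous (dampedSin a b) := by
  have := Real.continuous_sinc
  unfold dampedSin; fun_prop

theorem continuous_dampedCos (a b : ℝ) : Continuous (dampedCos a b) := by
  unfold dampedCos; fun_prop

theorem mul_mul_sinc (b r : ℝ) : b * (r * Real.sinc (b * r)) = Real.sin (b * r) := by
  by_cases h : b * r = 0
  · rw [← mul_assoc, h]; simp
  · rw [Real.sinc_of_ne_zero h, ← mul_assoc, mul_div_cancel₀ _ h]

theorem sub_mul_sinc (b r h : ℝ) : (r - h) * Real.sinc (b * (r - h)) =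
    Real.cos (b * h) * (r * Real.sinc (b * r)) - (h * Real.sinc (b * h)) * Real.cos (b * r) := by
  by_cases hb : b = 0
  · simp [hb]
  · apply mul_left_cancel₀ hb
    rw [mul_mul_sinc, mul_sub, Real.sin_sub, ← mul_mul_sinc b r, ← mul_mul_sinc b h]
    ring

/-- Angle addition separates r from h, with coefficients that are damped kernels for -a. Their
values and derivatives at h = 0 are all that is needed to compute the generator. -/
theorem dampedSin_sub (a b r h : ℝ) : dampedSin a b (r - h) =
    dampedCos (-a) b h * dampedSin a b r + -dampedSin (-a) b h * dampedCos a b r := by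
  unfold dampedSin dampedCos
  rw [sub_mul_sinc, show -a * (r - h) = -(-a) * h + -a * r by ring, Real.exp_add]
  ring

theorem dampedCos_sub (a b r h : ℝ) : dampedCos a b (r - h) =
    dampedCos (-a) b h * dampedCos a b r + b ^ 2 * dampedSin (-a) b h * dampedSin a b r := by
  unfold dampedSin dampedCos
  rw [mul_sub b, Real.cos_sub, show -a * (r - h) = -(-a) * h + -a * r by ring, Real.exp_add,
    ← mul_mul_sinc b r, ← mul_mul_sinc b h]
  ring

theorem hasDerivAt_dampedSin_zero (a b : ℝ) : HasDerivAt (dampedSin a b) 1 0 := by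
  have h1 : HasDerivAt (fun r : ℝ => r * Real.sinc (b * r)) 1 0 := by
    by_cases hb : b = 0
    · simpa [hb] using hasDerivAt_id' (0 : ℝ)
    · have h : (fun r : ℝ => r * Real.sinc (b * r)) = fun r => Real.sin (b * r) / b := by
        ext r
        rw [eq_div_iff hb, mul_comm, mul_mul_sinc]
      rw [h]
      have h2 := (((hasDerivAt_id (0 : ℝ)).const_mul b).sin).div_const b
      simpa [hb] using h2
  have h2 := (((hasDerivAt_id (0 : ℝ)).const_mul (-a)).exp).fun_mul h1
  refine h2.congr_deriv ?_
  simp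

theorem hasDerivAt_dampedCos_zero (a b : ℝ) : HasDerivAt (dampedCos a b) (-a) 0 := by
  have h2 := (((hasDerivAt_id (0 : ℝ)).const_mul (-a)).exp).fun_mul
    (((hasDerivAt_id (0 : ℝ)).const_mul b).cos)
  refine h2.congr_deriv ?_
  simp

theorem integrableOn_exp_mul_exp {a ω : ℝ} (h : ω < a) :
    IntegrableOn (fun r : ℝ => Real.exp (-a * r) * Real.exp (ω * r)) (Ioi 0) := by
  refine (integrableOn_exp_mul_Ioi (a := ω - a) (by linarith) 0).congr_fun (fun r _ => ?_)
    measurableSet_Ioi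
  simp only
  rw [← Real.exp_add]; ring_nf

theorem integrableOn_dampedSin_mul_exp {a ω : ℝ} (h : ω < a) (b : ℝ) :
    IntegrableOn (fun r => dampedSin a b r * Real.exp (ω * r)) (Ioi 0) := by
  refine (integrableOn_mul_exp_neg (sub_pos.2 h)).mono'
    ((continuous_dampedSin a b).mul (by fun_prop)).aestronglyMeasurable ?_
  filter_upwards [ae_restrict_mem measurableSet_Ioi] with r hr
  have hr : 0 < r := hr
  rw [dampedSin, norm_mul, norm_mul, norm_mul, Real.norm_of_nonneg (Real.exp_nonneg _),
    Real.norm_of_nonneg (Real.exp_nonneg _), Real.norm_of_nonneg hr.le,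
    show -(a - ω) * r = -a * r + ω * r by ring, Real.exp_add, Real.norm_eq_abs]
  have h2 := mul_le_mul_of_nonneg_left (Real.abs_sinc_le_one (b * r))
    (show 0 ≤ r * (Real.exp (-a * r) * Real.exp (ω * r)) by positivity)
  linarith

theorem integrableOn_dampedCos_mul_exp {a ω : ℝ} (h : ω < a) (b : ℝ) :
    IntegrableOn (fun r => dampedCos a b r * Real.exp (ω * r)) (Ioi 0) := by
  refine (integrableOn_exp_mul_exp h).mono'
    ((continuous_dampedCos a b).mul (by fun_prop)).aestronglyMeasurable (ae_of_all _ fun r => ?_)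
  rw [dampedCos, norm_mul, norm_mul, Real.norm_of_nonneg (Real.exp_nonneg _),
    Real.norm_of_nonneg (Real.exp_nonneg _), Real.norm_eq_abs]
  have h2 := mul_le_mul_of_nonneg_left (Real.abs_cos_le_one (b * r))
    (show 0 ≤ Real.exp (-a * r) * Real.exp (ω * r) by positivity)
  linarith

/-! ### Laplace type integrals of a group -/

section Group

variable {V : Type*} [NormedAddCommGroup V] [Module ℍ[ℝ]ᵐᵒᵖ V]

/-- The growth bound `‖Z(t)‖ ≤ M e^{ω|t|}`. -/
def GrowthBound (Z : ℝ → V →L[ℍ[ℝ]ᵐᵒᵖ] V) (M ω : ℝ) : Prop :=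
  ∀ t v, ‖Z t v‖ ≤ M * Real.exp (ω * |t|) * ‖v‖

variable {Z : ℝ → V →L[ℍ[ℝ]ᵐᵒᵖ] V} {M ω : ℝ}

theorem IsStronglyContinuousGroup.reverse (hZ : IsStronglyContinuousGroup Z) :
    IsStronglyContinuousGroup fun t => Z (-t) where
  map_zero := by rw [neg_zero, hZ.map_zero]
  map_add t₁ t₂ := by rw [neg_add, hZ.map_add]
  continuous_apply v := (hZ.continuous_apply v).comp continuous_neg

theorem GrowthBound.reverse (hb : GrowthBound Z M ω) : GrowthBound (fun t => Z (-t)) M ω :=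
  fun t v => by simpa using hb (-t) v

theorem IsStronglyContinuousGroup.zero_apply (hZ : IsStronglyContinuousGroup Z) (v : V) :
    Z 0 v = v := by rw [hZ.map_zero]; rfl

theorem IsStronglyContinuousGroup.add_apply (hZ : IsStronglyContinuousGroup Z) (t₁ t₂ : ℝ)
    (v : V) : Z (t₁ + t₂) v = Z t₁ (Z t₂ v) := by rw [hZ.map_add]; rfl

theorem IsStronglyContinuousGroup.comm_apply (hZ : IsStronglyContinuousGroup Z) (t₁ t₂ : ℝ)
    (v : V) : Z t₁ (Z t₂ v) = Z t₂ (Z t₁ v) := by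
  rw [← hZ.add_apply, add_comm, hZ.add_apply]

variable [NormedSpace ℝ V]

/-- The integral `∫₀^∞ κ(r) Z(r) v dr`. -/
def kernelIntegral (Z : ℝ → V →L[ℍ[ℝ]ᵐᵒᵖ] V) (κ : ℝ → ℝ) (v : V) : V :=
  ∫ r in Ioi (0 : ℝ), κ r • Z r v

theorem HasGenValue.of_hasDerivAt (hZ : IsStronglyContinuousGroup Z) {v w : V}
    (h : HasDerivAt (fun t => Z t v) w 0) : HasGenValue Z v w := by
  have h1 := (hasDerivAt_iff_tendsto_slope_zero.1 h).mono_left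
    (nhdsWithin_mono _ (fun x (hx : 0 < x) => hx.ne' : Ioi (0 : ℝ) ⊆ {0}ᶜ))
  refine h1.congr fun h => ?_
  rw [zero_add, hZ.zero_apply]

theorem HasGenValue.map_of_commute [IsScalarTower ℝ ℍ[ℝ]ᵐᵒᵖ V] {v w : V} (h : HasGenValue Z v w)
    (B : V →L[ℍ[ℝ]ᵐᵒᵖ] V) (hB : ∀ t x, B (Z t x) = Z t (B x)) : HasGenValue Z (B v) (B w) := by
  refine ((B.continuous.tendsto w).comp h).congr fun r => ?_
  simp only [Function.comp_apply]
  rw [← hB, ← map_sub]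
  exact map_smul (B.restrictScalars ℝ) _ _

/-- The generator is a one-sided limit, so this is not a mere change of sign. It uses (Z(-r)v - v)/r
= -Z(-r)((Z(r)v - v)/r), the local boundedness of Z(-r) and its strong continuity. -/
theorem HasGenValue.reverse [IsScalarTower ℝ ℍ[ℝ]ᵐᵒᵖ V] (hZ : IsStronglyContinuousGroup Z)
    (hb : GrowthBound Z M ω) {v w : V} (h : HasGenValue Z v w) :
    HasGenValue (fun t => Z (-t)) v (-w) := by
  have h0 : Tendsto (fun r : ℝ => M * Real.exp (ω * |-r|) * ‖r⁻¹ • (Z r v - v) - w‖)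
      (𝓝[>] 0) (𝓝 0) := by
    have h1 : Tendsto (fun r : ℝ => M * Real.exp (ω * |-r|)) (𝓝[>] 0)
        (𝓝 (M * Real.exp (ω * |-0|))) :=
      Continuous.tendsto' (by fun_prop) _ _ rfl |>.mono_left nhdsWithin_le_nhds
    have h2 := h1.mul (h.sub_const w).norm
    rwa [sub_self, norm_zero, mul_zero] at h2
  have h1 : Tendsto (fun r : ℝ => Z (-r) (r⁻¹ • (Z r v - v) - w)) (𝓝[>] 0) (𝓝 0) :=
    squeeze_zero_norm (fun r => hb (-r) _) h0
  have h2 : Tendsto (fun r : ℝ => Z (-r) w) (𝓝[>] 0) (𝓝 w) :=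
    Continuous.tendsto' ((hZ.continuous_apply w).comp continuous_neg) _ _
      (by simp [hZ.zero_apply]) |>.mono_left nhdsWithin_le_nhds
  have h3 := (h1.add h2).neg
  rw [zero_add] at h3
  refine h3.congr fun r => ?_
  rw [← map_add, sub_add_cancel,
    show Z (-r) (r⁻¹ • (Z r v - v)) = r⁻¹ • Z (-r) (Z r v - v) from
      map_smul ((Z (-r)).restrictScalars ℝ) _ _, map_sub, ← hZ.add_apply, neg_add_cancel,
    hZ.zero_apply, ← smul_neg, neg_sub]

theorem HasGenValue.of_reverse [IsScalarTower ℝ ℍ[ℝ]ᵐᵒᵖ V] (hZ : IsStronglyContinuousGroup Z)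
    (hb : GrowthBound Z M ω) {v w : V} (h : HasGenValue (fun t => Z (-t)) v w) :
    HasGenValue Z v (-w) := by
  simpa using h.reverse hZ.reverse hb.reverse

theorem HasGenValue.sub {v w v' w' : V} (h : HasGenValue Z v w) (h' : HasGenValue Z v' w') :
    HasGenValue Z (v - v') (w - w') := by
  refine (Filter.Tendsto.sub h h').congr fun r => ?_
  rw [map_sub, ← smul_sub]
  congr 1
  abel

theorem HasGenValue.real_smul [IsScalarTower ℝ ℍ[ℝ]ᵐᵒᵖ V] {v w : V} (a : ℝ)
    (h : HasGenValue Z v w) : HasGenValue Z (a • v) (a • w) := by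
  refine (Filter.Tendsto.const_smul h a).congr fun r => ?_
  rw [show Z r (a • v) = a • Z r v from map_smul ((Z r).restrictScalars ℝ) _ _, ← smul_sub,
    smul_comm]

theorem integrableOn_smul_orbit (hZ : IsStronglyContinuousGroup Z) (hb : GrowthBound Z M ω)
    {κ : ℝ → ℝ} (hκ : Continuous κ)
    (hi : IntegrableOn (fun r => κ r * Real.exp (ω * r)) (Ioi 0)) (v : V) :
    IntegrableOn (fun r => κ r • Z r v) (Ioi 0) := by
  refine (hi.norm.mul_const (M * ‖v‖)).mono' (hκ.smul (hZ.continuous_apply v)).aestronglyMeasurable ?_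
  filter_upwards [ae_restrict_mem measurableSet_Ioi] with r hr
  have h := hb r v
  rw [abs_of_pos hr] at h
  rw [norm_smul, norm_mul, Real.norm_of_nonneg (Real.exp_nonneg _)]
  calc ‖κ r‖ * ‖Z r v‖ ≤ ‖κ r‖ * (M * Real.exp (ω * r) * ‖v‖) := by gcongr
    _ = _ := by ring

/-- `v ↦ ∫₀^∞ κ(r) Z(r) v dr` is a bounded right linear operator. -/
theorem exists_kernelOperator [IsScalarTower ℝ ℍ[ℝ]ᵐᵒᵖ V] [NormSMulClass ℍ[ℝ]ᵐᵒᵖ V]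
    (hZ : IsStronglyContinuousGroup Z) (hb : GrowthBound Z M ω)
    {κ : ℝ → ℝ} (hκ : Continuous κ)
    (hi : IntegrableOn (fun r => κ r * Real.exp (ω * r)) (Ioi 0)) :
    ∃ B : V →L[ℍ[ℝ]ᵐᵒᵖ] V, ∀ v, B v = kernelIntegral Z κ v := by
  have : SMulCommClass ℝ ℍ[ℝ]ᵐᵒᵖ V := IsScalarTower.to_smulCommClass
  let A : V →ₗ[ℍ[ℝ]ᵐᵒᵖ] V :=
    { toFun := kernelIntegral Z κ
      map_add' := fun v w => by
        unfold kernelIntegral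
        simp_rw [map_add, smul_add]
        exact integral_add (integrableOn_smul_orbit hZ hb hκ hi v)
          (integrableOn_smul_orbit hZ hb hκ hi w)
      map_smul' := fun q v => by
        unfold kernelIntegral
        simp_rw [map_smul, smul_comm _ q]
        exact (integrableOn_smul_orbit hZ hb hκ hi v).integral_smul q }
  refine ⟨A.mkContinuous ((∫ r in Ioi (0 : ℝ), ‖κ r * Real.exp (ω * r)‖) * M) fun v => ?_,
    fun v => rfl⟩
  change ‖kernelIntegral Z κ v‖ ≤ _
  rw [mul_assoc, ← integral_mul_const]
  refine norm_integral_le_of_norm_le (hi.norm.mul_const _) ?_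
  filter_upwards [ae_restrict_mem measurableSet_Ioi] with r hr
  have h := hb r v
  rw [abs_of_pos hr] at h
  rw [norm_smul, norm_mul, Real.norm_of_nonneg (Real.exp_nonneg _)]
  calc ‖κ r‖ * ‖Z r v‖ ≤ ‖κ r‖ * (M * Real.exp (ω * r) * ‖v‖) := by gcongr
    _ = _ := by ring

theorem apply_kernelIntegral [IsScalarTower ℝ ℍ[ℝ]ᵐᵒᵖ V] [CompleteSpace V]
    (hZ : IsStronglyContinuousGroup Z) (hb : GrowthBound Z M ω)
    {κ : ℝ → ℝ} (hκ : Continuous κ)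
    (hi : IntegrableOn (fun r => κ r * Real.exp (ω * r)) (Ioi 0)) (t : ℝ) (v : V) :
    Z t (kernelIntegral Z κ v) = kernelIntegral Z κ (Z t v) := by
  have h := ((Z t).restrictScalars ℝ).integral_comp_comm (integrableOn_smul_orbit hZ hb hκ hi v)
  simp only [map_smul, ContinuousLinearMap.coe_restrictScalars', hZ.comm_apply t] at h
  exact h.symm

/-- Translation invariance of the span of the kernels `κ` and `κ₂` gives the generator on
`∫₀^∞ κ(r) Z(r) v dr`. -/
theorem hasGenValue_kernelIntegral [IsScalarTower ℝ ℍ[ℝ]ᵐᵒᵖ V] [CompleteSpace V]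
    (hZ : IsStronglyContinuousGroup Z) (hb : GrowthBound Z M ω)
    {κ κ₂ : ℝ → ℝ} (hκ : Continuous κ) (hκ₂ : Continuous κ₂)
    (hi : IntegrableOn (fun r => κ r * Real.exp (ω * r)) (Ioi 0))
    (hi₂ : IntegrableOn (fun r => κ₂ r * Real.exp (ω * r)) (Ioi 0))
    {p q : ℝ → ℝ} {p' q' : ℝ} (hp : HasDerivAt p p' 0) (hq : HasDerivAt q q' 0)
    (hp0 : p 0 = 1) (hq0 : q 0 = 0)
    (hpq : ∀ r h, κ (r - h) = p h * κ r + q h * κ₂ r) (v : V) :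
    HasGenValue Z (kernelIntegral Z κ v)
      (p' • kernelIntegral Z κ v + q' • kernelIntegral Z κ₂ v - κ 0 • v) := by
  have hloc : ∀ {μ : ℝ → ℝ} (hμ : Continuous μ) (h : ℝ),
      IntervalIntegrable (fun r => μ r • Z r v) volume 0 h := fun hμ h =>
    (hμ.smul (hZ.continuous_apply v)).intervalIntegrable _ _
  have htail : ∀ {μ : ℝ → ℝ} (hμ : Continuous μ)
      (hμi : IntegrableOn (fun r => μ r * Real.exp (ω * r)) (Ioi 0)) (h : ℝ),
      IntegrableOn (fun r => μ r • Z r v) (Ioi h) := by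
    intro μ hμ hμi h
    have h1 := integrableOn_smul_orbit hZ hb hμ hμi v
    rcases le_total 0 h with h0 | h0
    · exact h1.mono_set (Ioi_subset_Ioi h0)
    · rw [← Ioc_union_Ioi_eq_Ioi h0]
      exact (((hμ.smul (hZ.continuous_apply v)).integrableOn_Icc).mono_set Ioc_subset_Icc_self).union
        h1
  have hder : ∀ {μ : ℝ → ℝ} (hμ : Continuous μ)
      (hμi : IntegrableOn (fun r => μ r * Real.exp (ω * r)) (Ioi 0)),
      HasDerivAt (fun h => ∫ r in Ioi h, μ r • Z r v) (-(μ 0 • v)) 0 := by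
    intro μ hμ hμi
    have hc : Continuous fun r => μ r • Z r v := hμ.smul (hZ.continuous_apply v)
    have h1 := (intervalIntegral.integral_hasDerivAt_right (hloc hμ 0)
      (hc.stronglyMeasurableAtFilter _ _) hc.continuousAt).const_sub (∫ r in Ioi (0 : ℝ), μ r • Z r v)
    rw [hZ.zero_apply] at h1
    refine h1.congr_of_eventuallyEq (Eventually.of_forall fun h => ?_)
    simp only
    rw [← intervalIntegral.integral_interval_add_Ioi (htail hμ hμi 0) (htail hμ hμi h)]
    abel
  -- Substituting r ↦ r - h and using `hpq` leaves h only in the coefficients and the lower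
  -- endpoint, so the product rule applies.
  have hshift : ∀ h, Z h (kernelIntegral Z κ v) =
      p h • (∫ r in Ioi h, κ r • Z r v) + q h • ∫ r in Ioi h, κ₂ r • Z r v := by
    intro h
    have h1 : (∫ r in Ioi (0 : ℝ), κ r • Z (r + h) v) = ∫ r in Ioi h, κ (r - h) • Z r v := by
      have := (measurePreserving_add_right volume h).setIntegral_preimage_emb
        (measurableEmbedding_addRight h) (fun r => κ (r - h) • Z r v) (Ioi h)
      rw [← this]
      simp
    rw [apply_kernelIntegral hZ hb hκ hi, kernelIntegral]
    simp_rw [← hZ.add_apply]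
    rw [h1, ← integral_smul, ← integral_smul, ← integral_add ((htail hκ hi h).fun_smul _)
      ((htail hκ₂ hi₂ h).fun_smul _)]
    simp_rw [hpq, add_smul, mul_smul]
  refine HasGenValue.of_hasDerivAt hZ ?_
  rw [funext hshift]
  have h1 := (hp.fun_smul (hder hκ hi)).fun_add (hq.fun_smul (hder hκ₂ hi₂))
  refine h1.congr_deriv ?_
  rw [hp0, hq0]
  unfold kernelIntegral
  module

section Damped

variable [IsScalarTower ℝ ℍ[ℝ]ᵐᵒᵖ V] [CompleteSpace V]

theorem hasGenValue_dampedSin (hZ : IsStronglyContinuousGroup Z) (hb : GrowthBound Z M ω)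
    {a : ℝ} (ha : ω < a) (b : ℝ) (v : V) :
    HasGenValue Z (kernelIntegral Z (dampedSin a b) v)
      (a • kernelIntegral Z (dampedSin a b) v - kernelIntegral Z (dampedCos a b) v) := by
  have h := hasGenValue_kernelIntegral hZ hb (continuous_dampedSin a b) (continuous_dampedCos a b)
    (integrableOn_dampedSin_mul_exp ha b) (integrableOn_dampedCos_mul_exp ha b)
    (hasDerivAt_dampedCos_zero (-a) b) (hasDerivAt_dampedSin_zero (-a) b).fun_neg
    (by simp [dampedCos]) (by simp [dampedSin]) (fun r h => dampedSin_sub a b r h) v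
  convert h using 1
  simp [dampedSin]
  abel

theorem hasGenValue_dampedCos (hZ : IsStronglyContinuousGroup Z) (hb : GrowthBound Z M ω)
    {a : ℝ} (ha : ω < a) (b : ℝ) (v : V) :
    HasGenValue Z (kernelIntegral Z (dampedCos a b) v)
      (a • kernelIntegral Z (dampedCos a b) v + b ^ 2 • kernelIntegral Z (dampedSin a b) v - v) := by
  have h := hasGenValue_kernelIntegral hZ hb (continuous_dampedCos a b) (continuous_dampedSin a b)
    (integrableOn_dampedCos_mul_exp ha b) (integrableOn_dampedSin_mul_exp ha b)
    (hasDerivAt_dampedCos_zero (-a) b) ((hasDerivAt_dampedSin_zero (-a) b).const_mul (b ^ 2))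
    (by simp [dampedCos]) (by simp [dampedSin]) (fun r h => dampedCos_sub a b r h) v
  convert h using 1
  simp [dampedCos]

/-- The second application of the generator to `∫₀^∞ e^{-ar} sin(br)/b Z(r) v dr`. -/
theorem hasGenValue_dampedSin_sq (hZ : IsStronglyContinuousGroup Z) (hb : GrowthBound Z M ω)
    {a : ℝ} (ha : ω < a) (b : ℝ) (v : V) :
    HasGenValue Z
      (a • kernelIntegral Z (dampedSin a b) v - kernelIntegral Z (dampedCos a b) v)
      (v + (2 * a) • (a • kernelIntegral Z (dampedSin a b) v - kernelIntegral Z (dampedCos a b) v) -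
        (a ^ 2 + b ^ 2) • kernelIntegral Z (dampedSin a b) v) := by
  convert ((hasGenValue_dampedSin hZ hb ha b v).real_smul a).sub
    (hasGenValue_dampedCos hZ hb ha b v) using 1
  module

/-- `∫₀^∞ e^{-ar} sin(br)/b Z(r) dr` is a left inverse of `T² - 2aT + (a² + b²)`. -/
theorem kernelIntegral_dampedSin_quad [NormSMulClass ℍ[ℝ]ᵐᵒᵖ V]
    (hZ : IsStronglyContinuousGroup Z) (hb : GrowthBound Z M ω)
    {a : ℝ} (ha : ω < a) (b : ℝ) {x w₁ w₂ : V} (h₁ : HasGenValue Z x w₁)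
    (h₂ : HasGenValue Z w₁ w₂) :
    kernelIntegral Z (dampedSin a b) (w₂ - (2 * a) • w₁ + (a ^ 2 + b ^ 2) • x) = x := by
  obtain ⟨B, hB⟩ := exists_kernelOperator hZ hb (continuous_dampedSin a b)
    (integrableOn_dampedSin_mul_exp ha b)
  have hcomm : ∀ t x, B (Z t x) = Z t (B x) := fun t x => by
    rw [hB, hB, apply_kernelIntegral hZ hb (continuous_dampedSin a b)
      (integrableOn_dampedSin_mul_exp ha b)]
  -- B commutes with the group, hence with T on D(T); the right inverse relation thus becomes a left
  -- one.
  have e₁ := (h₁.map_of_commute B hcomm).unique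
    (by rw [hB]; exact hasGenValue_dampedSin hZ hb ha b x)
  have e₂ := (h₂.map_of_commute B hcomm).unique
    (by rw [e₁]; exact hasGenValue_dampedSin_sq hZ hb ha b x)
  have hsm : ∀ (y : ℝ) (x : V), B (y • x) = y • B x := fun y x =>
    map_smul (B.restrictScalars ℝ) y x
  rw [← hB, map_add, map_sub, hsm, hsm, e₂, e₁, hB x]
  abel

end Damped

end Group

/-! ### The action of `ℂ_I` -/

section PlaneAction

variable {V : Type*} [AddCommGroup V] [Module ℝ V] [Module ℍ[ℝ] V] [IsScalarTower ℝ ℍ[ℝ] V]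
  {I : ℍ[ℝ]}

theorem planeHom_ofReal_smul (hI : I ∈ imagUnits) (y : ℝ) (v : V) :
    planeHom I hI (y : ℂ) • v = y • v := by
  rw [planeHom_apply]
  simp only [Complex.ofReal_re, Complex.ofReal_im, zero_smul, add_zero]
  rw [show (y : ℍ[ℝ]) = y • (1 : ℍ[ℝ]) from by rw [← Quaternion.coe_one]; ext <;> simp, smul_assoc,
    one_smul]

/-- Splits e^{-(a+Ib)r} into the real kernels, so that I can be taken out of the Laplace integral.
-/
theorem planeHom_cexp_smul (hI : I ∈ imagUnits) (a b r : ℝ) (v : V) :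
    planeHom I hI (Complex.exp (-linePt a b * r)) • v =
      dampedCos a b r • v - b • (I • dampedSin a b r • v) := by
  have : SMulCommClass ℝ ℍ[ℝ] V := IsScalarTower.to_smulCommClass
  have h : Complex.exp (-linePt a b * r) =
      (dampedCos a b r : ℂ) - (b * dampedSin a b r : ℝ) * Complex.I := by
    have e : b * dampedSin a b r = Real.exp (-a * r) * Real.sin (b * r) := by
      rw [← mul_mul_sinc, dampedSin]; ring
    rw [e, dampedCos, show -linePt a b * r = ((-a * r : ℝ) : ℂ) + ((-(b * r) : ℝ) : ℂ) * Complex.I by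
      unfold linePt; push_cast; ring, Complex.exp_add, Complex.exp_mul_I, ← Complex.ofReal_exp,
      ← Complex.ofReal_cos, ← Complex.ofReal_sin, Real.cos_neg, Real.sin_neg]
    push_cast
    ring
  have hIm : planeHom I hI Complex.I = I := by simp [planeHom_apply]
  rw [h, map_sub, map_mul, hIm, sub_smul, mul_smul, planeHom_ofReal_smul, planeHom_ofReal_smul,
    mul_smul, smul_comm (dampedSin a b r) I v]

end PlaneAction

/-- The `ℂ_I`-valued Laplace transform of an orbit in terms of real kernels. -/
theorem integral_planeHom_cexp_smul {V : Type*} [NormedAddCommGroup V] [NormedSpace ℝ V]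
    [Module ℍ[ℝ]ᵐᵒᵖ V] [Module ℍ[ℝ] V] [IsScalarTower ℝ ℍ[ℝ] V] [NormSMulClass ℍ[ℝ] V]
    {Z : ℝ → V →L[ℍ[ℝ]ᵐᵒᵖ] V} {M ω : ℝ} {I : ℍ[ℝ]} (hZ : IsStronglyContinuousGroup Z) (hb : GrowthBound Z M ω)
    (hI : I ∈ imagUnits) {a : ℝ} (ha : ω < a) (b : ℝ) (v : V) :
    ∫ r in Ioi (0 : ℝ), planeHom I hI (Complex.exp (-linePt a b * r)) • Z r v =
      kernelIntegral Z (dampedCos a b) v - b • (I • kernelIntegral Z (dampedSin a b) v) := by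
  have : SMulCommClass ℝ ℍ[ℝ] V := IsScalarTower.to_smulCommClass
  simp_rw [planeHom_cexp_smul]
  have h1 := integrableOn_smul_orbit hZ hb (continuous_dampedCos a b)
    (integrableOn_dampedCos_mul_exp ha b) v
  have h2 := integrableOn_smul_orbit hZ hb (continuous_dampedSin a b)
    (integrableOn_dampedSin_mul_exp ha b) v
  rw [integral_sub h1 ((h2.fun_smul I).fun_smul b), integral_smul, integral_smul]
  rfl

/-! ### The `S`-resolvent of the generator -/

section Resolvent

variable {V : Type*} [NormedAddCommGroup V] [NormedSpace ℝ V] [Module ℍ[ℝ]ᵐᵒᵖ V]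
  [IsScalarTower ℝ ℍ[ℝ]ᵐᵒᵖ V] [NormSMulClass ℍ[ℝ]ᵐᵒᵖ V]
  {Z : ℝ → V →L[ℍ[ℝ]ᵐᵒᵖ] V}

theorem hasGenValue_generator (x : (generator Z).domain) : HasGenValue Z x (generator Z x) :=
  x.2.choose_spec

theorem generator_apply {v w : V} (h : HasGenValue Z v w) (hv : v ∈ (generator Z).domain) :
    generator Z ⟨v, hv⟩ = w :=
  (hasGenValue_generator ⟨v, hv⟩).unique h

theorem mem_domain_opSq_generator {x w₁ w₂ : V} (h₁ : HasGenValue Z x w₁)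
    (h₂ : HasGenValue Z w₁ w₂) : x ∈ (opSq (generator Z)).domain :=
  ⟨⟨w₁, h₁⟩, ⟨w₂, (generator_apply h₁ ⟨w₁, h₁⟩).symm ▸ h₂⟩⟩

theorem quadOp_generator (s : ℍ[ℝ]) {x w₁ w₂ : V} (h₁ : HasGenValue Z x w₁)
    (h₂ : HasGenValue Z w₁ w₂) (hx : x ∈ (opSq (generator Z)).domain) :
    quadOp (generator Z) s ⟨x, hx⟩ = w₂ - (2 * s.re) • w₁ + (‖s‖ ^ 2) • x := by
  have e₁ : generator Z ⟨x, hx.1⟩ = w₁ := generator_apply h₁ _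
  have e₂ : opSq (generator Z) ⟨x, hx⟩ = w₂ := generator_apply (by rw [e₁]; exact h₂) hx.2
  rw [quadOp, e₁, e₂]

/-- Written with `0 ^ 2` so that (α - T)² appears as T² - 2aT + (a² + b²) at a = α, b = 0, which the
kernel r e^{-αr} inverts. -/
theorem opSq_realSub_generator (α : ℝ) {u : V}
    (hu : u ∈ (opSq (generator Z)).domain)
    (hu' : u ∈ (opSq (realSub α (generator Z))).domain) :
    ∃ w₁ w₂, HasGenValue Z u w₁ ∧ HasGenValue Z w₁ w₂ ∧
      opSq (realSub α (generator Z)) ⟨u, hu'⟩ = w₂ - (2 * α) • w₁ + (α ^ 2 + 0 ^ 2) • u := by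
  have h₁ := hasGenValue_generator (Z := Z) ⟨u, hu.1⟩
  have h₂ := hasGenValue_generator (Z := Z) ⟨_, hu.2⟩
  refine ⟨_, _, h₁, h₂, ?_⟩
  have h₃ := (h₁.real_smul α).sub h₂
  have e : opSq (realSub α (generator Z)) ⟨u, hu'⟩ =
      α • (α • u - generator Z ⟨u, hu.1⟩) -
        generator Z ⟨α • u - generator Z ⟨u, hu.1⟩, ⟨_, h₃⟩⟩ := rfl
  have e' : generator Z ⟨α • u - generator Z ⟨u, hu.1⟩, ⟨_, h₃⟩⟩ = _ := generator_apply h₃ ⟨_, h₃⟩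
  refine (e.trans (congrArg _ e')).trans ?_
  module

/-- Here `D` plays the role of TB, and `hE` is the equation R_s(T)B = 1 solved for T(TB). -/
theorem mem_sResolventSet_of_inverse {s : ℍ[ℝ]} (B : V →L[ℍ[ℝ]ᵐᵒᵖ] V) (D : V → V)
    (hD : ∀ v, HasGenValue Z (B v) (D v))
    (hE : ∀ v, HasGenValue Z (D v) (v + (2 * s.re) • D v - (‖s‖ ^ 2) • B v))
    (hinj : ∀ x w₁ w₂, HasGenValue Z x w₁ → HasGenValue Z w₁ w₂ →
      w₂ - (2 * s.re) • w₁ + (‖s‖ ^ 2) • x = 0 → x = 0) :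
    s ∈ sResolventSet (generator Z) := by
  have hB : IsRightInverseQuadOp (generator Z) s B := fun v =>
    ⟨mem_domain_opSq_generator (hD v) (hE v), by
      rw [quadOp_generator s (hD v) (hE v)]; abel⟩
  refine ⟨fun x hx => Subtype.ext ?_, ?_, B, hB⟩
  · have h₁ := hasGenValue_generator (Z := Z) ⟨x.1, x.2.1⟩
    have h₂ := hasGenValue_generator (Z := Z) ⟨_, x.2.2⟩
    exact hinj _ _ _ h₁ h₂ hx
  · exact Function.Surjective.denseRange fun v => ⟨⟨B v, (hB v).1⟩, (hB v).2⟩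

/-- The inverse is a chosen operator; injectivity of R_s(T) identifies its values with any explicit
solution. -/
theorem quadInv_eq_of_inverse {s : ℍ[ℝ]} (hs : s ∈ sResolventSet (generator Z)) {v x w₁ w₂ : V}
    (h₁ : HasGenValue Z x w₁) (h₂ : HasGenValue Z w₁ w₂)
    (hv : w₂ - (2 * s.re) • w₁ + (‖s‖ ^ 2) • x = v) : quadInv (generator Z) s hs v = x := by
  obtain ⟨hm, hq⟩ := quadInv_spec (generator Z) s hs v
  have k₁ := hasGenValue_generator (Z := Z) ⟨_, hm.1⟩
  have k₂ := hasGenValue_generator (Z := Z) ⟨_, hm.2⟩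
  have h0 := hs.1 ⟨_, mem_domain_opSq_generator (k₁.sub h₁) (k₂.sub h₂)⟩ (by
    rw [quadOp_generator s (k₁.sub h₁) (k₂.sub h₂)]
    rw [quadOp_generator s k₁ k₂] at hq
    rw [smul_sub, smul_sub, ← sub_eq_zero.2 (hq.trans hv.symm)]
    abel)
  exact sub_eq_zero.1 (congrArg Subtype.val h0)

theorem sResolventR_eq_of_inverse [Module ℍ[ℝ] V] {s : ℍ[ℝ]}
    (hs : s ∈ sResolventSet (generator Z)) {v x w₁ w₂ : V}
    (h₁ : HasGenValue Z x w₁) (h₂ : HasGenValue Z w₁ w₂)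
    (hv : w₂ - (2 * s.re) • w₁ + (‖s‖ ^ 2) • x = v) :
    sResolventR (generator Z) s v = star s • x - w₁ := by
  have e := quadInv_eq_of_inverse hs h₁ h₂ hv
  rw [sResolventR, dif_pos hs, neg_sub, generator_apply (by rw [e]; exact h₁), e]

variable [CompleteSpace V] {M ω : ℝ} {I : ℍ[ℝ]}

theorem norm_sq_planeHom_linePt (hI : I ∈ imagUnits) (a b : ℝ) :
    ‖planeHom I hI (linePt a b)‖ ^ 2 = a ^ 2 + b ^ 2 := by
  rw [norm_planeHom, ← Complex.normSq_eq_norm_sq, Complex.normSq_apply]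
  simp
  ring

theorem planeHom_linePt_re (hI : I ∈ imagUnits) (a b : ℝ) :
    (planeHom I hI (linePt a b)).re = a := by
  simp [planeHom_apply, hI.1]

theorem mem_sResolventSet_right (hZ : IsStronglyContinuousGroup Z) (hb : GrowthBound Z M ω)
    (hI : I ∈ imagUnits) {a : ℝ} (ha : ω < a) (b : ℝ) :
    planeHom I hI (linePt a b) ∈ sResolventSet (generator Z) := by
  obtain ⟨B, hB⟩ := exists_kernelOperator hZ hb (continuous_dampedSin a b)
    (integrableOn_dampedSin_mul_exp ha b)
  refine mem_sResolventSet_of_inverse B _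
    (fun v => by rw [hB]; exact hasGenValue_dampedSin hZ hb ha b v) (fun v => ?_) ?_
  · rw [planeHom_linePt_re, norm_sq_planeHom_linePt, hB]
    exact hasGenValue_dampedSin_sq hZ hb ha b v
  · intro x w₁ w₂ h₁ h₂ h
    rw [planeHom_linePt_re, norm_sq_planeHom_linePt] at h
    rw [← kernelIntegral_dampedSin_quad hZ hb ha b h₁ h₂, h, ← hB, map_zero]

/-- The reversed group has generator -T, and R_s(T) = R_{-s}(-T) with Re(-s) > ω. -/
theorem mem_sResolventSet_left (hZ : IsStronglyContinuousGroup Z) (hb : GrowthBound Z M ω)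
    (hI : I ∈ imagUnits) {a : ℝ} (ha : ω < a) (b : ℝ) :
    -planeHom I hI (linePt a b) ∈ sResolventSet (generator Z) := by
  obtain ⟨B, hB⟩ := exists_kernelOperator hZ.reverse hb.reverse (continuous_dampedSin a b)
    (integrableOn_dampedSin_mul_exp ha b)
  refine mem_sResolventSet_of_inverse B _
    (fun v => by
      rw [hB]; exact (hasGenValue_dampedSin hZ.reverse hb.reverse ha b v).of_reverse hZ hb)
    (fun v => ?_) ?_
  · rw [Quaternion.re_neg, norm_neg, planeHom_linePt_re, norm_sq_planeHom_linePt, hB]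
    convert ((hasGenValue_dampedSin_sq hZ.reverse hb.reverse ha b v).of_reverse hZ hb).real_smul (-1)
      using 1 <;> module
  · intro x w₁ w₂ h₁ h₂ h
    rw [Quaternion.re_neg, norm_neg, planeHom_linePt_re, norm_sq_planeHom_linePt] at h
    have h₂' : HasGenValue (fun t => Z (-t)) (-w₁) w₂ := by
      simpa using (h₂.reverse hZ hb).real_smul (-1)
    rw [← kernelIntegral_dampedSin_quad hZ.reverse hb.reverse ha b (h₁.reverse hZ hb) h₂',
      ← hB, ← map_zero B, ← h]
    congr 1
    module

variable [Module ℍ[ℝ] V] [IsScalarTower ℝ ℍ[ℝ] V] [NormSMulClass ℍ[ℝ] V]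

/-- With B and C the sine and cosine integrals, TB = aB - C, so s̄B - TB = (a - bI)B - aB + C = C -
bIB. -/
theorem sResolventR_right (hZ : IsStronglyContinuousGroup Z) (hb : GrowthBound Z M ω)
    (hI : I ∈ imagUnits) {a : ℝ} (ha : ω < a) (b : ℝ) (v : V) :
    sResolventR (generator Z) (planeHom I hI (linePt a b)) v =
      ∫ r in Ioi (0 : ℝ), planeHom I hI (Complex.exp (-linePt a b * r)) • Z r v := by
  rw [sResolventR_eq_of_inverse (mem_sResolventSet_right hZ hb hI ha b)
    (hasGenValue_dampedSin hZ hb ha b v) (hasGenValue_dampedSin_sq hZ hb ha b v)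
    (by rw [planeHom_linePt_re, norm_sq_planeHom_linePt]; abel),
    integral_planeHom_cexp_smul hZ hb hI ha b]
  have h : star (planeHom I hI (linePt a b)) = planeHom I hI a - b • I := by
    ext <;> simp [planeHom_apply, hI.1]
  rw [h, sub_smul, planeHom_ofReal_smul, smul_assoc]
  abel

theorem sResolventR_left (hZ : IsStronglyContinuousGroup Z) (hb : GrowthBound Z M ω)
    (hI : I ∈ imagUnits) {a : ℝ} (ha : ω < a) (b : ℝ) (v : V) :
    sResolventR (generator Z) (-planeHom I hI (linePt a b)) v =
      -∫ r in Ioi (0 : ℝ), planeHom I hI (Complex.exp (-linePt a b * r)) • Z (-r) v := by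
  have h2 := ((hasGenValue_dampedSin_sq hZ.reverse hb.reverse ha b v).of_reverse hZ hb).real_smul
    (-1)
  rw [neg_one_smul, neg_one_smul, neg_neg] at h2
  rw [sResolventR_eq_of_inverse (mem_sResolventSet_left hZ hb hI ha b)
    ((hasGenValue_dampedSin hZ.reverse hb.reverse ha b v).of_reverse hZ hb) h2
    (by rw [Quaternion.re_neg, norm_neg, planeHom_linePt_re, norm_sq_planeHom_linePt]; module),
    integral_planeHom_cexp_smul hZ.reverse hb.reverse hI ha b]
  have h : star (-planeHom I hI (linePt a b)) = -(planeHom I hI a - b • I) := by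
    ext <;> simp [planeHom_apply, hI.1]
  rw [h, neg_smul, sub_smul, planeHom_ofReal_smul, smul_assoc]
  abel

end Resolvent

/-! ### Domination for Fubini's theorem -/

theorem GrowthBound.orbit {V : Type*} [NormedAddCommGroup V] [Module ℍ[ℝ]ᵐᵒᵖ V]
    {Z : ℝ → V →L[ℍ[ℝ]ᵐᵒᵖ] V} {M ω : ℝ} (hb : GrowthBound Z M ω) (v : V) (r : ℝ) (hr : 0 < r) :
    ‖Z r v‖ ≤ (M * ‖v‖) * Real.exp (ω * r) := by
  have h := hb r v
  rw [abs_of_pos hr] at h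
  linarith

theorem integrable_uncurry_lineTransform {V : Type*} [NormedAddCommGroup V] [Module ℍ[ℝ] V]
    [NormSMulClass ℍ[ℝ] V] {I : ℍ[ℝ]} (hI : I ∈ imagUnits) {F : ℝ → V} (hF : Continuous F)
    {K ω c α : ℝ} (hFb : ∀ r, 0 < r → ‖F r‖ ≤ K * Real.exp (ω * r)) (hc : ω < c) (hα : α ≠ c)
    (t : ℝ) :
    Integrable (Function.uncurry fun τ r : ℝ =>
      planeHom I hI (Complex.exp ((t - r : ℝ) * linePt c τ) *
        ((α : ℂ) - linePt c τ) ^ (-2 : ℤ)) • F r) (volume.prod (volume.restrict (Ioi 0))) := by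
  -- The bound factors into |α - s|⁻², integrable in τ, and e^{(ω-c)r}, integrable in r.
  have h1 := (integrable_inv_sq_add_sq (sub_ne_zero.2 hα)).mul_prod
    ((integrableOn_exp_mul_exp hc).const_mul (Real.exp (t * c) * K))
  refine h1.mono' ?_ ?_
  · have hz := (continuous_sub_linePt_zpow hα).comp (continuous_fst (X := ℝ) (Y := ℝ))
    have hl := continuous_linePt c
    have hp := continuous_planeHom hI
    refine Continuous.aestronglyMeasurable ?_
    refine Continuous.smul (hp.comp (Continuous.mul ?_ hz)) (hF.comp continuous_snd)
    fun_prop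
  · have hmem : ∀ᵐ p : ℝ × ℝ ∂(volume.prod (volume.restrict (Ioi 0))), p.2 ∈ Ioi (0 : ℝ) :=
      Measure.quasiMeasurePreserving_snd.ae (ae_restrict_mem measurableSet_Ioi)
    filter_upwards [hmem] with p hp
    simp only [Function.uncurry]
    rw [norm_smul, norm_planeHom, norm_mul, norm_sub_linePt_zpow, Complex.norm_exp]
    have h2 : ((((t - p.2 : ℝ) : ℂ) * linePt c p.1).re) = t * c + -c * p.2 := by
      rw [Complex.re_ofReal_mul, linePt_re]; ring
    rw [h2, Real.exp_add]
    have h3 := mul_le_mul_of_nonneg_left (hFb p.2 hp)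
      (show 0 ≤ Real.exp (t * c) * Real.exp (-c * p.2) * ((α - c) ^ 2 + p.1 ^ 2)⁻¹ by positivity)
    refine h3.trans (le_of_eq ?_)
    ring

/-! ### Integrals of Laplace transforms along vertical lines -/

section Line

variable {V : Type*} [NormedAddCommGroup V] [NormedSpace ℝ V]
  [Module ℍ[ℝ] V] [IsScalarTower ℝ ℍ[ℝ] V]
  {I : ℍ[ℝ]}

theorem integral_planeHom_smul [CompleteSpace V] (hI : I ∈ imagUnits) {f : ℝ → ℂ}
    (hf : Integrable f) (v : V) :
    ∫ τ, planeHom I hI (f τ) • v = planeHom I hI (∫ τ, f τ) • v := by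
  let A : ℂ →ₗ[ℝ] V :=
    { toFun := fun z => planeHom I hI z • v
      map_add' := fun x y => by rw [map_add, add_smul]
      map_smul' := fun r x => by rw [map_smul, smul_assoc]; rfl }
  exact A.toContinuousLinearMap.integral_comp_comm hf

/-- The function `e^{ts} (α - s)⁻²` times the Laplace transform of `F`, at `s = c + I τ`. -/
def lineTransform (hI : I ∈ imagUnits) (c α t : ℝ) (F : ℝ → V) (τ : ℝ) : V :=
  planeHom I hI (Complex.exp (t * linePt c τ) * ((α : ℂ) - linePt c τ) ^ (-2 : ℤ)) •
    ∫ r in Ioi (0 : ℝ), planeHom I hI (Complex.exp (-linePt c τ * r)) • F r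

variable [NormSMulClass ℍ[ℝ] V]

theorem lineTransform_eq_integral (hI : I ∈ imagUnits) (c α t : ℝ) (F : ℝ → V) (τ : ℝ) :
    lineTransform hI c α t F τ =
      ∫ r in Ioi (0 : ℝ), planeHom I hI (Complex.exp ((t - r : ℝ) * linePt c τ) *
        ((α : ℂ) - linePt c τ) ^ (-2 : ℤ)) • F r := by
  have : SMulCommClass ℝ ℍ[ℝ] V := IsScalarTower.to_smulCommClass
  rw [lineTransform, ← integral_smul]
  congr 1
  ext r
  rw [← mul_smul, ← map_mul, mul_right_comm, ← Complex.exp_add]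
  congr 4
  push_cast
  ring

theorem integrable_lineTransform (hI : I ∈ imagUnits) {F : ℝ → V} (hF : Continuous F)
    {K ω c α : ℝ} (hFb : ∀ r, 0 < r → ‖F r‖ ≤ K * Real.exp (ω * r)) (hc : ω < c) (hα : α ≠ c)
    (t : ℝ) : Integrable (lineTransform hI c α t F) := by
  rw [funext (lineTransform_eq_integral hI c α t F)]
  exact (integrable_uncurry_lineTransform hI hF hFb hc hα t).integral_prod_left

theorem integral_lineTransform [CompleteSpace V] (hI : I ∈ imagUnits) {F : ℝ → V}
    (hF : Continuous F) {K ω c α : ℝ} (hFb : ∀ r, 0 < r → ‖F r‖ ≤ K * Real.exp (ω * r))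
    (hc : ω < c) (hα : α ≠ c) (t : ℝ) :
    ∫ τ, lineTransform hI c α t F τ = ∫ r in Ioi (0 : ℝ), planeHom I hI (∫ τ : ℝ,
      Complex.exp ((t - r : ℝ) * linePt c τ) * ((α : ℂ) - linePt c τ) ^ (-2 : ℤ)) • F r := by
  rw [funext (lineTransform_eq_integral hI c α t F),
    integral_integral_swap (integrable_uncurry_lineTransform hI hF hFb hc hα t)]
  congr 1
  ext r
  refine integral_planeHom_smul hI ?_ _
  refine ((integrable_inv_sq_add_sq (sub_ne_zero.2 hα)).const_mul (Real.exp ((t - r) * c))).mono'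
    ?_ (ae_of_all _ fun τ => ?_)
  · have hl := continuous_linePt c
    exact (Continuous.mul (by fun_prop) (continuous_sub_linePt_zpow hα)).aestronglyMeasurable
  · rw [norm_mul, norm_sub_linePt_zpow, Complex.norm_exp, Complex.re_ofReal_mul, linePt_re]

variable [CompleteSpace V] [Module ℍ[ℝ]ᵐᵒᵖ V] [IsScalarTower ℝ ℍ[ℝ]ᵐᵒᵖ V]
  {Z : ℝ → V →L[ℍ[ℝ]ᵐᵒᵖ] V} {M ω : ℝ}

/-- The two boundary lines together give `Z(t) (α - T)⁻² v`. -/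
theorem integral_lineTransform_add (hZ : IsStronglyContinuousGroup Z) (hb : GrowthBound Z M ω)
    (hI : I ∈ imagUnits) {c α : ℝ} (hω : 0 ≤ ω) (hc : ω < c) (hα : c < α) (t : ℝ) (v : V) :
    (∫ τ, lineTransform hI c α t (fun r => Z r v) τ) +
      ∫ τ, lineTransform hI c (-α) (-t) (fun r => Z (-r) v) τ =
    (2 * Real.pi) • Z t (kernelIntegral Z (dampedSin α 0) v) := by
  have hcont := hZ.continuous_apply v
  have hα' : -α < c := by linarith
  rw [integral_lineTransform hI hcont (hb.orbit v) hc hα.ne' t,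
    integral_lineTransform hI (hZ.reverse.continuous_apply v) (hb.reverse.orbit v) hc hα'.ne (-t)]
  simp_rw [integral_line_of_lt hα, integral_line_of_gt hα', planeHom_ofReal_smul]
  -- One integrand serves both lines: the right line integrates it over r > 0, the left one over r ≤
  -- 0 after r ↦ -r.
  set H : ℝ → V := fun r =>
    (2 * Real.pi * (max (-(t - r)) 0 * Real.exp (α * (t - r)))) • Z r v with hH
  have e2 : (∫ r in Ioi (0 : ℝ),
      (2 * Real.pi * (max (-t - r) 0 * Real.exp (-α * (-t - r)))) • Z (-r) v) =
      ∫ r in Iic (0 : ℝ), H r := by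
    have := integral_comp_neg_Ioi 0 H
    rw [neg_zero] at this
    rw [← this]
    congr 1
    ext r
    simp only [hH]
    congr 4
    · ring
    · ring
  -- The factor (r - t)₊ restricts the support to r > t, so the shift lands exactly on the half-line
  -- of the kernel integral.
  have hshift : (fun r => H (r + t)) = indicator (Ioi 0)
      fun r => (2 * Real.pi) • (dampedSin α 0 r • Z r (Z t v)) := by
    ext r
    by_cases hr : 0 < r
    · rw [indicator_of_mem (mem_Ioi.2 hr)]
      simp only [hH]
      rw [hZ.add_apply, smul_smul]
      congr 1
      rw [dampedSin, max_eq_left (by linarith)]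
      simp
      ring
    · rw [indicator_of_notMem (by simpa using hr)]
      simp only [hH]
      rw [max_eq_right (by linarith)]
      simp
  have hωα : ω < α := hc.trans hα
  have hi := integrableOn_smul_orbit hZ hb (continuous_dampedSin α 0)
    (integrableOn_dampedSin_mul_exp hωα 0) (Z t v)
  have hHi : Integrable H := by
    have h1 : Integrable fun r => H (r + t) := by
      rw [hshift, integrable_indicator_iff measurableSet_Ioi]
      exact hi.fun_smul _
    simpa using h1.comp_sub_right t
  rw [e2, add_comm, intervalIntegral.integral_Iic_add_Ioi hHi.integrableOn hHi.integrableOn,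
    ← integral_add_right_eq_self H t, hshift, integral_indicator measurableSet_Ioi, integral_smul,
    apply_kernelIntegral hZ hb (continuous_dampedSin α 0) (integrableOn_dampedSin_mul_exp hωα 0)]
  rfl

end Line

/-! ### The integrands of the strip integral -/

section Strip

variable {I : ℍ[ℝ]}

theorem exp_smul_planeHom (hI : I ∈ imagUnits) (t : ℝ) (z : ℂ) :
    NormedSpace.exp (t • planeHom I hI z) = planeHom I hI (Complex.exp (t * z)) := by
  rw [Complex.exp_eq_exp_ℂ, NormedSpace.map_exp (planeHom I hI) (continuous_planeHom hI),
    ← Complex.real_smul, map_smul]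

theorem sub_planeHom_zpow (hI : I ∈ imagUnits) (α : ℝ) (z : ℂ) :
    ((α : ℍ[ℝ]) - planeHom I hI z) ^ (-2 : ℤ) = planeHom I hI (((α : ℂ) - z) ^ (-2 : ℤ)) := by
  rw [map_zpow₀, map_sub]
  congr 2
  simp

variable {V : Type*} [NormedAddCommGroup V] [NormedSpace ℝ V] [CompleteSpace V]
  [Module ℍ[ℝ] V] [Module ℍ[ℝ]ᵐᵒᵖ V]
  [IsScalarTower ℝ ℍ[ℝ] V] [IsScalarTower ℝ ℍ[ℝ]ᵐᵒᵖ V]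
  [NormSMulClass ℍ[ℝ] V] [NormSMulClass ℍ[ℝ]ᵐᵒᵖ V]
  {Z : ℝ → V →L[ℍ[ℝ]ᵐᵒᵖ] V} {M ω : ℝ}

theorem add_smul_eq_planeHom (hI : I ∈ imagUnits) (c τ : ℝ) :
    (c : ℍ[ℝ]) + τ • I = planeHom I hI (linePt c τ) := by
  simp [planeHom_apply]

theorem neg_add_smul_neg_eq_planeHom (hI : I ∈ imagUnits) (c τ : ℝ) :
    -(c : ℍ[ℝ]) + τ • (-I) = -planeHom I hI (linePt c τ) := by
  rw [← add_smul_eq_planeHom, smul_neg, neg_add]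

theorem lineIntegrand_right (hZ : IsStronglyContinuousGroup Z) (hb : GrowthBound Z M ω)
    (hI : I ∈ imagUnits) {c : ℝ} (hc : ω < c) (α t : ℝ) (v : V) :
    lineIntegrand I (c : ℍ[ℝ]) I
      (fun s => NormedSpace.exp (t • s) * ((α : ℍ[ℝ]) - s) ^ (-2 : ℤ))
      (fun s => sResolventR (generator Z) s v) =
    lineTransform hI c α t fun r => Z r v := by
  ext τ
  rw [lineIntegrand, add_smul_eq_planeHom hI, sResolventR_right hZ hb hI hc, exp_smul_planeHom,
    sub_planeHom_zpow, ← map_mul, imagUnits.mul_self hI, neg_neg, mul_one, lineTransform]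

/-- With s = -z the weight is -((-I)I) = -1, which cancels the sign of the left resolvent; also (α +
z)⁻² = (-α - z)⁻², so α and t change sign. -/
theorem lineIntegrand_left (hZ : IsStronglyContinuousGroup Z) (hb : GrowthBound Z M ω)
    (hI : I ∈ imagUnits) {c : ℝ} (hc : ω < c) (α t : ℝ) (v : V) :
    lineIntegrand I (-(c : ℍ[ℝ])) (-I)
      (fun s => NormedSpace.exp (t • s) * ((α : ℍ[ℝ]) - s) ^ (-2 : ℤ))
      (fun s => sResolventR (generator Z) s v) =
    lineTransform hI c (-α) (-t) fun r => Z (-r) v := by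
  ext τ
  have h : ((α : ℍ[ℝ]) - -planeHom I hI (linePt c τ)) ^ (-2 : ℤ) =
      (((-α : ℝ) : ℍ[ℝ]) - planeHom I hI (linePt c τ)) ^ (-2 : ℤ) := by
    rw [← Even.neg_zpow (by decide)]
    congr 1
    push_cast
    abel
  rw [lineIntegrand, neg_add_smul_neg_eq_planeHom hI, sResolventR_left hZ hb hI hc, smul_neg,
    ← neg_smul, smul_neg, ← neg_smul t, exp_smul_planeHom, h, sub_planeHom_zpow, ← map_mul, neg_mul, neg_neg,
    imagUnits.mul_self hI, mul_neg_one, neg_neg, lineTransform]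

end Strip

end QuatGroup

end

/-! ### The integral representation of the group -/

theorem proposition4p2 {V : Type*} [NormedAddCommGroup V] [NormedSpace ℝ V] [CompleteSpace V]
    [Module ℍ[ℝ] V] [Module ℍ[ℝ]ᵐᵒᵖ V] [SMulCommClass ℍ[ℝ] ℍ[ℝ]ᵐᵒᵖ V]
    [IsScalarTower ℝ ℍ[ℝ] V] [IsScalarTower ℝ ℍ[ℝ]ᵐᵒᵖ V]
    [NormSMulClass ℍ[ℝ] V] [NormSMulClass ℍ[ℝ]ᵐᵒᵖ V]
    (Z : ℝ → V →L[ℍ[ℝ]ᵐᵒᵖ] V) (hZ : IsStronglyContinuousGroup Z)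
    (T : V →ₗ.[ℍ[ℝ]ᵐᵒᵖ] V) (hT : T = generator Z)
    (M ω : ℝ) (hM : 0 < M) (hω : 0 ≤ ω)
    (hbound : ∀ t v, ‖Z t v‖ ≤ M * Real.exp (ω * |t|) * ‖v‖)
    (α c : ℝ) (hωc : ω < c) (hcα : c < |α|)
    (I : ℍ[ℝ]) (hI : I ∈ imagUnits)
    (u : V) (hu : u ∈ (opSq T).domain) (t : ℝ) :
    (∀ τ : ℝ, (c : ℍ[ℝ]) + τ • I ∈ sResolventSet T ∧
      -(c : ℍ[ℝ]) + τ • (-I) ∈ sResolventSet T) ∧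
    StripIntegrable c I
      (fun s => NormedSpace.exp (t • s) * ((α : ℍ[ℝ]) - s) ^ (-2 : ℤ))
      (fun s => sResolventR T s (opSq (realSub α T) ⟨u, mem_domain_opSq_realSub α T hu⟩)) ∧
    Z t u = (1 / (2 * Real.pi)) • stripIntegral c I
      (fun s => NormedSpace.exp (t • s) * ((α : ℍ[ℝ]) - s) ^ (-2 : ℤ))
      (fun s => sResolventR T s (opSq (realSub α T) ⟨u, mem_domain_opSq_realSub α T hu⟩)) := by
  subst hT
  have hb : GrowthBound Z M ω := hbound
  have hc0 : 0 < c := hω.trans_lt hωc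
  have hne : α ≠ c := by
    rintro rfl
    exact absurd hcα (by rw [abs_of_pos hc0]; exact lt_irrefl _)
  have hne' : -α ≠ c := fun h => by
    rw [← abs_neg, h, abs_of_pos hc0] at hcα
    exact lt_irrefl _ hcα
  obtain ⟨w₁, w₂, h₁, h₂, hv⟩ :=
    opSq_realSub_generator α hu (mem_domain_opSq_realSub α (generator Z) hu)
  refine ⟨fun τ => ?_, ?_, ?_⟩
  · rw [add_smul_eq_planeHom hI, neg_add_smul_neg_eq_planeHom hI]
    exact ⟨mem_sResolventSet_right hZ hb hI hωc τ, mem_sResolventSet_left hZ hb hI hωc τ⟩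
  · rw [StripIntegrable, lineIntegrand_right hZ hb hI hωc, lineIntegrand_left hZ hb hI hωc]
    exact ⟨integrable_lineTransform hI (hZ.continuous_apply _) (hb.orbit _) hωc hne t,
      integrable_lineTransform hI (hZ.reverse.continuous_apply _) (hb.reverse.orbit _) hωc hne' _⟩
  · rw [stripIntegral, lineIntegrand_right hZ hb hI hωc, lineIntegrand_left hZ hb hI hωc, hv]
    rcases lt_abs.1 hcα with hα | hα
    · rw [integral_lineTransform_add hZ hb hI hω hωc hα,
        kernelIntegral_dampedSin_quad hZ hb (hωc.trans hα) 0 h₁ h₂, smul_smul,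
        one_div_mul_cancel (by positivity), one_smul]
    -- For α < -c the data (Z(-·), -α, -t) satisfy the previous case; the two lines exchange roles,
    -- hence the `add_comm` below.
    · have h := integral_lineTransform_add hZ.reverse hb.reverse hI hω hωc hα (-t)
        (w₂ - (2 * α) • w₁ + (α ^ 2 + 0 ^ 2) • u)
      simp only [neg_neg] at h
      have h₂' : HasGenValue (fun t => Z (-t)) (-w₁) w₂ := by
        simpa using (h₂.reverse hZ hb).real_smul (-1)
      have hq := kernelIntegral_dampedSin_quad hZ.reverse hb.reverse (hωc.trans hα) 0
        (h₁.reverse hZ hb) h₂'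
      rw [mul_neg, neg_smul_neg, neg_sq] at hq
      rw [add_comm, h, hq, smul_smul, one_div_mul_cancel (by positivity), one_smul]
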